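/- **Setting.** There are $K$ users; user $k$ has channel matrix $H_k\in\mathbb C^{N_R\times N_k}$. A composite covariance matrix is $Q=Q_1\oplus\cdots\oplus Q_K$ with $Q_k\in\mathbb C^{N_k\times N_k}$. Let $\mathcal P=\{Q : Q\succeq 0,\ g_\ell(Q)\le 0,\ \ell=1,\dots,L\}$ for real-valued functions $g_1,\dots,g_L$. For a decoding order $\pi$ (a permutation of the users; $\pi(j)$ is the user decoded in position $j$) the rate of user $k$ is $$r_{k\pi}(Q)=\log\frac{\bigl|I+\sum_{j\ge\pi^{-1}(k)}H_{\pi(j)}Q_{\pi(j)}H_{\pi(j)}^\dagger\bigr|}{\bigl|I+\sum_{j>\pi^{-1}(k)}H_{\pi(j)}Q_{\pi(j)}H_{\pi(j)}^\dagger\bigr|}.$$ For $\beta\in\mathcal S=\{\beta\in\mathbb R^{K!}:\beta\ge0,\ \sum_\pi\beta_\pi=1\}$ put $\hat\rho_k(\beta,Q)=\sum_\pi\beta_\pi r_{k\pi}(Q)$. The problem is $$\min_{\beta\in\mathcal S,\ Q\in\mathcal P} f\bigl(\hat\rho(\beta,Q)\bigr).\tag{MACP2}$$ **Algorithm.** Fix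 $\sigma,\chi\in(0,1)$ and start from any $\beta(0)\in\mathcal S$, $Q(0)\in\mathcal P$. For $t=1,2,\dots$: 1. Compute $w_k(t)=-\frac{\partial f}{\partial x_k}(x)$ at $x=\hat\rho(\beta(t-1),Q(t-1))$. 2. With the users relabelled so that $w_1(t)\le\cdots\le w_K(t)$, and $w_0(t)=0$, choose a maximizer $\tilde Q(t)$ over $Q\in\mathcal P$ of $\sum_{k=1}^K(w_k(t)-w_{k-1}(t))\log\bigl|I+\sum_{j\ge k}H_jQ_jH_j^\dagger\bigr|$. 3. With $h(\delta,t)=f\bigl(\hat\rho(\beta(t-1),\delta\tilde Q(t)+(1-\delta)Q(t-1))\bigr)$, let $\varepsilon(t)$ be the largest element of $\{\chi^n:n=0,1,\dots\}$ with $h(\varepsilon(t),t)\le h(0,t)+\sigma\,\varepsilon(t)\,\frac{\partial h}{\partial\delta}(0,t)$; if no element satisfies this, put $\varepsilon(t)=0$. Set $Q(t)=\varepsilon(t)\tilde Q(t)+(1-\varepsilon(t))Q(t-1)$. 4. Choose a minimizer $\beta(t)$ of $f(\hat\rho(\beta,Q(t)))$ over $\beta\in\mathcal S$ that uses (that is,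 $\beta_\pi(t)>0$) only decoding orders $\pi$ which are optimum for the linear objective with weights $w=w(t+1)=-\nabla f(\hat\rho(\beta(t),Q(t)))$, that is, $\sum_kw_kr_{k\pi}(Q)\ge\sum_kw_kr_{k\pi'}(Q)$ for all $Q\in\mathcal P$ and all orders $\pi'$. **Theorem.** Suppose that $\mathcal P$ is convex and compact, and that $f$, on an open convex set $U\subseteq\mathbb R^K$ containing all rate vectors $\hat\rho(\beta,Q)$ with $\beta\in\mathcal S$, $Q\in\mathcal P$, is twice differentiable, nonincreasing in each component, and convex. (It is not assumed that $f(\hat\rho(\beta,Q))$ is convex in $\beta$ and $Q$.) Then the algorithm can be carried out for all $t$ from every $\beta(0)\in\mathcal S$ and $Q(0)\in\mathcal P$. Moreover, for every sequence of iterates that it can produce, (MACP2) has an optimum, and for every optimum $(\beta^\star,Q^\star)$, with optimum rate vector $x^\star=\hat\rho(\beta^\star,Q^\star)$, $$\lim_{t\to\infty}\Bigl(f\bigl(\hat\rho(\beta(t),Q(t))\bigr)-f(x^\star)\Bigr)=0 .$$ -/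

import Mathlib

open Filter Topology
open scoped ComplexOrder

namespace GMAC

/-- A composite covariance matrix `Q₁ ⊕ ⋯ ⊕ Q_K`, given by its diagonal blocks; the `k`-th block
is an `N k × N k` complex matrix. -/
abbrev CompCov {K : ℕ} (N : Fin K → ℕ) : Type :=
  (k : Fin K) → Matrix (Fin (N k)) (Fin (N k)) ℂ

/-- The channel matrices: `H k` is the `NR × N k` channel matrix of user `k`. -/
abbrev Channel {K : ℕ} (NR : ℕ) (N : Fin K → ℕ) : Type :=
  (k : Fin K) → Matrix (Fin NR) (Fin (N k)) ℂ

/-- The feasible set: all blocks are positive semidefinite (equivalently, the composite matrix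
is), and the `L` power constraints `g ℓ Q ≤ 0` hold. -/
def feasible {K L : ℕ} {N : Fin K → ℕ} (g : Fin L → CompCov N → ℝ) : Set (CompCov N) :=
  {Q | (∀ k, (Q k).PosSemidef) ∧ ∀ l, g l Q ≤ 0}

/-- `|I + ∑_{j ∈ S} H_{π j} Q_{π j} H_{π j}†|`, for a set `S` of decoding positions. The
determinant is real for Hermitian blocks. -/
noncomputable def sigDet {K NR : ℕ} {N : Fin K → ℕ} (H : Channel NR N) (Q : CompCov N)
    (π : Equiv.Perm (Fin K)) (S : Finset (Fin K)) : ℝ :=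
  (1 + ∑ j ∈ S, H (π j) * Q (π j) * (H (π j)).conjTranspose).det.re

/-- The rate of user `k` under successive interference cancellation with decoding order `π`,
where `π j` is the user that is decoded in position `j`. -/
noncomputable def rate {K NR : ℕ} {N : Fin K → ℕ} (H : Channel NR N)
    (π : Equiv.Perm (Fin K)) (k : Fin K) (Q : CompCov N) : ℝ :=
  Real.log (sigDet H Q π (Finset.Ici (π.symm k)) / sigDet H Q π (Finset.Ioi (π.symm k)))

/-- The rate vector obtained by time-sharing the decoding orders with coefficients `β`. -/
noncomputable def rateVec {K NR : ℕ} {N : Fin K → ℕ} (H : Channel NR N)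
    (β : Equiv.Perm (Fin K) → ℝ) (Q : CompCov N) : Fin K → ℝ :=
  fun k => ∑ π, β π * rate H π k Q

/-- The weights `w_k = - ∂f/∂x_k` at the rate vector `x`. -/
noncomputable def weights {K : ℕ} (f : (Fin K → ℝ) → ℝ) (x : Fin K → ℝ) : Fin K → ℝ :=
  fun k => -(fderiv ℝ f x (Pi.single k 1))

/-- The weight that precedes position `k` in the list `v`, with `0` in front of the list. -/
def prevWeight {K : ℕ} (v : Fin K → ℝ) (k : Fin K) : ℝ :=
  if (k : ℕ) = 0 then 0 else v ⟨(k : ℕ) - 1, lt_of_le_of_lt (Nat.sub_le _ _) k.isLt⟩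

/-- `∑_k (w_k - w_{k-1}) log |I + ∑_{j ≥ k} H_j Q_j H_j†|`, where `w_0 = 0` and the users are
relabelled by `π`. -/
noncomputable def covObjective {K NR : ℕ} {N : Fin K → ℕ} (H : Channel NR N)
    (w : Fin K → ℝ) (π : Equiv.Perm (Fin K)) (Q : CompCov N) : ℝ :=
  ∑ k, (w (π k) - prevWeight (fun j => w (π j)) k) * Real.log (sigDet H Q π (Finset.Ici k))

/-- `Q` maximizes `covObjective` over `P`, the users being relabelled so that the weights are
nondecreasing. -/
def IsCovSolution {K NR : ℕ} {N : Fin K → ℕ} (H : Channel NR N) (P : Set (CompCov N))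
    (w : Fin K → ℝ) (Q : CompCov N) : Prop :=
  ∃ π : Equiv.Perm (Fin K), Monotone (fun k => w (π k)) ∧ Q ∈ P ∧
    ∀ Q' ∈ P, covObjective H w π Q' ≤ covObjective H w π Q

/-- The decoding order `π` is optimum for the linear rate objective with weights `w`: with any
covariance matrices in `P` its weighted sum rate is the largest among all decoding orders. -/
def IsOptimalOrder {K NR : ℕ} {N : Fin K → ℕ} (H : Channel NR N) (P : Set (CompCov N))
    (w : Fin K → ℝ) (π : Equiv.Perm (Fin K)) : Prop :=
  ∀ Q ∈ P, ∀ π' : Equiv.Perm (Fin K), ∑ k, w k * rate H π' k Q ≤ ∑ k, w k * rate H π k Q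

/-- The objective along the segment from `Q` (at `δ = 0`) to `Q'` (at `δ = 1`). -/
noncomputable def lineObjective {K NR : ℕ} {N : Fin K → ℕ} (H : Channel NR N)
    (f : (Fin K → ℝ) → ℝ) (β : Equiv.Perm (Fin K) → ℝ) (Q Q' : CompCov N) (δ : ℝ) : ℝ :=
  f (rateVec H β (δ • Q' + (1 - δ) • Q))

/-- The candidate step sizes `χ ^ n` that satisfy the Armijo condition for `h`. -/
def armijoSet (σ χ : ℝ) (h : ℝ → ℝ) : Set ℝ :=
  {ε | (∃ n : ℕ, ε = χ ^ n) ∧ h ε ≤ h 0 + σ * ε * deriv h 0}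

/-- `ε` is the Armijo step size: the largest `χ ^ n` that satisfies the Armijo condition. If there
is none, no step is made. -/
def IsArmijoStep (σ χ : ℝ) (h : ℝ → ℝ) (ε : ℝ) : Prop :=
  IsGreatest (armijoSet σ χ h) ε ∨ (armijoSet σ χ h = ∅ ∧ ε = 0)

/-- `β` minimizes the objective over the simplex for the given `Q`, and it only uses decoding
orders that are optimum for the linear objective defined by the weights at the resulting rate
vector. -/
def IsTimeSharing {K NR : ℕ} {N : Fin K → ℕ} (H : Channel NR N) (P : Set (CompCov N))
    (f : (Fin K → ℝ) → ℝ) (Q : CompCov N) (β : Equiv.Perm (Fin K) → ℝ) : Prop :=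
  β ∈ stdSimplex ℝ (Equiv.Perm (Fin K)) ∧
  (∀ β' ∈ stdSimplex ℝ (Equiv.Perm (Fin K)), f (rateVec H β Q) ≤ f (rateVec H β' Q)) ∧
  ∀ π, 0 < β π → IsOptimalOrder H P (weights f (rateVec H β Q)) π

/-- `(β t, Q t)` are the iterates of the algorithm; `Qs (t + 1)` and `ε (t + 1)` are the solution
of the covariance search and the step size in iteration `t + 1`. -/
structure IsRun {K NR : ℕ} {N : Fin K → ℕ} (H : Channel NR N) (P : Set (CompCov N))
    (f : (Fin K → ℝ) → ℝ) (σ χ : ℝ) (β : ℕ → Equiv.Perm (Fin K) → ℝ) (Q Qs : ℕ → CompCov N)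
    (ε : ℕ → ℝ) : Prop where
  init_time : β 0 ∈ stdSimplex ℝ (Equiv.Perm (Fin K))
  init_cov : Q 0 ∈ P
  search : ∀ t, IsCovSolution H P (weights f (rateVec H (β t) (Q t))) (Qs (t + 1))
  stepsize : ∀ t, IsArmijoStep σ χ (lineObjective H f (β t) (Q t) (Qs (t + 1))) (ε (t + 1))
  update : ∀ t, Q (t + 1) = ε (t + 1) • Qs (t + 1) + (1 - ε (t + 1)) • Q t
  time : ∀ t, IsTimeSharing H P f (Q (t + 1)) (β (t + 1))

/-- `(β, Q)` is a global minimizer of `f (rateVec H β Q)` over the simplex and `P`. -/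
def IsOptimum {K NR : ℕ} {N : Fin K → ℕ} (H : Channel NR N) (P : Set (CompCov N))
    (f : (Fin K → ℝ) → ℝ) (β : Equiv.Perm (Fin K) → ℝ) (Q : CompCov N) : Prop :=
  β ∈ stdSimplex ℝ (Equiv.Perm (Fin K)) ∧ Q ∈ P ∧
  ∀ β' ∈ stdSimplex ℝ (Equiv.Perm (Fin K)), ∀ Q' ∈ P,
    f (rateVec H β Q) ≤ f (rateVec H β' Q')

end GMAC

/-! For fixed `Q`, the vectors of rates of the decoding orders are the greedy vertices of a
polymatroid, because `log det` is submodular (`log_det_add_sub_le`). Hence an order that sorts the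
weights maximizes the weighted sum rate (`sum_mul_marginal_le`), and its value is `covObjective`.
With nonnegative weights this function is concave in `Q`, although the individual rates need not be.

The key estimate is `sub_le_neg_deriv_lineObjective`. Since `β` uses only optimum orders, the
weighted sum rate under `β` equals `covObjective` on all of `P`, so the two have the same derivative
along feasible segments. Convexity of `f` bounds the optimality gap by a difference of weighted
rates, the choice of `Qs` bounds this by an increment of `covObjective`, and concavity bounds the
increment by its derivative, which is the descent rate of `f`. Joint convexity in `(β, Q)` is never
needed.

Derivatives are uniformly continuous on the compact parameter set, so Armijo steps stay away from
zero while the gap does (`exists_lineObjective_le`). Each iteration then removes at least `σ * ε`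
times the gap, which forces it to zero (`tendsto_zero_of_descent`).

The time-sharing step can be carried out because a minimizing rate vector lies on a face of the
polymatroid spanned by the vertices of sorting orders (`exists_simplex_monotone_rateVec_eq`). -/

namespace GMAC

/-! ### Submodularity and concavity of `log det`. -/

section MatrixFacts

variable {n : Type*} [Fintype n] [DecidableEq n]

open Matrix in
lemma det_re_pos {A : Matrix n n ℂ} (hA : A.PosDef) : 0 < A.det.re :=
  (Complex.pos_iff.1 hA.det_pos).1

open Matrix in
lemma ofReal_det_re {A : Matrix n n ℂ} (hA : A.PosDef) : (A.det.re : ℂ) = A.det :=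
  Complex.ext rfl (Complex.pos_iff.1 hA.det_pos).2

open Matrix in
-- Diagonalizing `W` reduces determinant inequalities to scalar ones about the eigenvalues.
lemma det_one_add_smul_eq_prod {W : Matrix n n ℂ} (hW : W.IsHermitian) (c : ℝ) :
    (1 + c • W).det = ((∏ i, (1 + c * hW.eigenvalues i) : ℝ) : ℂ) := by
  set V : Matrix n n ℂ := (hW.eigenvectorUnitary : Matrix n n ℂ) with hV
  have hVV : V * star V = 1 := Unitary.mul_star_self_of_mem hW.eigenvectorUnitary.2
  set D : Matrix n n ℂ := diagonal (fun i => (hW.eigenvalues i : ℂ)) with hD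
  have hspec : W = V * D * star V := by
    have h := hW.spectral_theorem
    rw [Unitary.conjStarAlgAut_apply] at h
    exact h
  have h1 : 1 + c • W = V * (1 + c • D) * star V := by
    conv_lhs => rw [hspec, ← hVV]
    simp [mul_add, add_mul]
  have h2 : (1 + c • D : Matrix n n ℂ)
      = diagonal (fun i => ((1 + c * hW.eigenvalues i : ℝ) : ℂ)) := by
    rw [hD, ← diagonal_one]
    ext i j
    by_cases hij : i = j
    · subst hij; simp
    · simp [hij]
  rw [h1, det_mul, det_mul, mul_right_comm, ← det_mul, hVV, det_one, one_mul, h2, det_diagonal]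
  push_cast
  rfl

open Matrix in
open scoped MatrixOrder Matrix.Norms.L2Operator in
lemma exists_eq_conjTranspose_mul_self {A : Matrix n n ℂ} (hA : A.PosSemidef) :
    ∃ B : Matrix n n ℂ, A = Bᴴ * B :=
  CStarAlgebra.nonneg_iff_eq_star_mul_self.1 hA.nonneg

open Matrix in
lemma exists_isUnit_mul_conjTranspose {A : Matrix n n ℂ} (hA : A.PosDef) :
    ∃ C : Matrix n n ℂ, IsUnit C.det ∧ A = C * Cᴴ := by
  obtain ⟨B, hB⟩ := exists_eq_conjTranspose_mul_self hA.posSemidef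
  refine ⟨Bᴴ, ?_, ?_⟩
  · have h : A.det = star B.det * B.det := by
      rw [hB, det_mul, det_conjTranspose]
    have hne : A.det ≠ 0 := hA.det_pos.ne'
    rw [isUnit_iff_ne_zero, det_conjTranspose]
    intro h0
    exact hne (by rw [h, h0, zero_mul])
  · rw [conjTranspose_conjTranspose]; exact hB

open Matrix in
lemma one_le_det_one_add {W : Matrix n n ℂ} (hW : W.PosSemidef) : 1 ≤ (1 + W).det.re := by
  have h := det_one_add_smul_eq_prod hW.1 1
  rw [one_smul] at h
  rw [h, Complex.ofReal_re]
  refine Finset.one_le_prod fun i _ => ?_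
  have := hW.eigenvalues_nonneg i
  show 1 ≤ 1 + 1 * hW.1.eigenvalues i
  linarith

open Matrix in
lemma det_re_le_det_re_add {A Y : Matrix n n ℂ} (hA : A.PosDef) (hY : Y.PosSemidef) :
    A.det.re ≤ (A + Y).det.re := by
  obtain ⟨B, hB⟩ := exists_eq_conjTranspose_mul_self hY
  have hu : IsUnit A.det := isUnit_iff_ne_zero.2 hA.det_pos.ne'
  rw [hB, det_add_mul _ _ hu, ← ofReal_det_re hA, Complex.re_ofReal_mul, Complex.ofReal_re]
  exact le_mul_of_one_le_right (det_re_pos hA).le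
    (one_le_det_one_add (hA.posSemidef.inv.mul_mul_conjTranspose_same B))

open Matrix in
-- The difference is congruent, via `(M + X)⁻¹`, to `X + X * M⁻¹ * X`, a sum of two positive
-- semidefinite matrices.
lemma posSemidef_inv_sub_inv_add {M X : Matrix n n ℂ} (hM : M.PosDef) (hX : X.PosSemidef) :
    (M⁻¹ - (M + X)⁻¹).PosSemidef := by
  have hMX : (M + X).PosDef := hM.add_posSemidef hX
  have u1 : IsUnit M.det := isUnit_iff_ne_zero.2 hM.det_pos.ne'
  have u2 : IsUnit (M + X).det := isUnit_iff_ne_zero.2 hMX.det_pos.ne'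
  have h : M⁻¹ - (M + X)⁻¹ = (M + X)⁻¹ * (X + X * M⁻¹ * X) * ((M + X)⁻¹)ᴴ := by
    rw [hMX.inv.isHermitian.eq]
    have e : X + X * M⁻¹ * X = (M + X) * (M⁻¹ - (M + X)⁻¹) * (M + X) := by
      rw [mul_sub, mul_nonsing_inv _ u2, sub_mul, one_mul, add_mul M X, mul_nonsing_inv _ u1,
        add_mul, one_mul, mul_add (X * M⁻¹), nonsing_inv_mul_cancel_right _ _ u1]
      abel
    rw [e, ← mul_assoc, ← mul_assoc, nonsing_inv_mul _ u2, one_mul, mul_assoc,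
      mul_nonsing_inv _ u2, mul_one]
  rw [h]
  refine (hX.add ?_).mul_mul_conjTranspose_same _
  have := hM.posSemidef.inv.mul_mul_conjTranspose_same X
  rwa [hX.isHermitian.eq] at this

open Matrix in
/-- The function `log det` is submodular along positive semidefinite increments. -/
lemma log_det_add_sub_le {M X Y : Matrix n n ℂ} (hM : M.PosDef) (hX : X.PosSemidef)
    (hY : Y.PosSemidef) :
    Real.log (M + X + Y).det.re - Real.log (M + X).det.re
      ≤ Real.log (M + Y).det.re - Real.log M.det.re := by
  have hMX : (M + X).PosDef := hM.add_posSemidef hX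
  obtain ⟨B, hB⟩ := exists_eq_conjTranspose_mul_self hY
  -- The matrix determinant lemma expresses the increment through `A⁻¹`; submodularity then follows
  -- from antitonicity of the inverse.
  have key : ∀ {A : Matrix n n ℂ}, A.PosDef → (1 + B * A⁻¹ * Bᴴ).PosDef ∧
      Real.log (A + Y).det.re - Real.log A.det.re = Real.log (1 + B * A⁻¹ * Bᴴ).det.re := by
    intro A hA
    have hp : (1 + B * A⁻¹ * Bᴴ).PosDef :=
      PosDef.one.add_posSemidef (hA.posSemidef.inv.mul_mul_conjTranspose_same B)
    refine ⟨hp, ?_⟩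
    rw [hB, det_add_mul _ _ (isUnit_iff_ne_zero.2 hA.det_pos.ne'), ← ofReal_det_re hA,
      Complex.re_ofReal_mul, Complex.ofReal_re,
      Real.log_mul (det_re_pos hA).ne' (det_re_pos hp).ne']
    ring
  rw [(key hMX).2, (key hM).2]
  refine Real.log_le_log (det_re_pos (key hMX).1) ?_
  have h := det_re_le_det_re_add (key hMX).1
    ((posSemidef_inv_sub_inv_add hM hX).mul_mul_conjTranspose_same B)
  have e : 1 + B * (M + X)⁻¹ * Bᴴ + B * (M⁻¹ - (M + X)⁻¹) * Bᴴ = 1 + B * M⁻¹ * Bᴴ := by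
    rw [mul_sub, sub_mul]; abel
  rwa [e] at h

open Matrix in
/-- The function `log det` is concave on the positive definite matrices. -/
lemma log_det_concave {A B : Matrix n n ℂ} (hA : A.PosDef) (hB : B.PosDef) {δ : ℝ}
    (h0 : 0 ≤ δ) (h1 : δ ≤ 1) :
    (1 - δ) * Real.log A.det.re + δ * Real.log B.det.re
      ≤ Real.log (δ • B + (1 - δ) • A).det.re := by
  obtain ⟨C, hC, hAC⟩ := exists_isUnit_mul_conjTranspose hA
  have hCu : IsUnit Cᴴ.det := by rw [det_conjTranspose]; exact hC.star
  -- Congruence by `C` moves `A` to the identity, so the whole segment is diagonalized by the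
  -- eigenvectors of `M - 1`.
  set M : Matrix n n ℂ := C⁻¹ * B * (C⁻¹)ᴴ with hM
  have hMB : B = C * M * Cᴴ := by
    rw [hM, conjTranspose_nonsing_inv, ← mul_assoc, ← mul_assoc, mul_nonsing_inv _ hC, one_mul,
      mul_assoc, nonsing_inv_mul _ hCu, mul_one]
  have hMpd : M.PosDef := by
    refine hB.mul_mul_conjTranspose_same ?_
    have : IsUnit C⁻¹ := by
      rw [isUnit_nonsing_inv_iff]; exact (isUnit_iff_isUnit_det C).2 hC
    exact vecMul_injective_of_isUnit this
  have hW : (M - 1).IsHermitian := hMpd.isHermitian.sub isHermitian_one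
  have hdet : ∀ c : ℝ, (c • B + (1 - c) • A).det.re
      = A.det.re * ∏ i, (1 + c * hW.eigenvalues i) := by
    intro c
    have e : c • B + (1 - c) • A = C * (1 + c • (M - 1)) * Cᴴ := by
      rw [hMB, hAC]
      simp only [mul_add, add_mul, mul_sub, sub_mul, mul_one, sub_smul, one_smul, smul_sub,
        Matrix.mul_smul, Matrix.smul_mul]
      abel
    rw [e, det_mul, det_mul, mul_right_comm, ← det_mul, ← hAC, det_one_add_smul_eq_prod,
      ← ofReal_det_re hA, ← Complex.ofReal_mul, Complex.ofReal_re, Complex.ofReal_re]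
  have hpos : ∀ i, 0 < 1 + hW.eigenvalues i := by
    intro i
    have hv := hW.mulVec_eigenvectorBasis i
    have hne : (⇑(hW.eigenvectorBasis i) : n → ℂ) ≠ 0 := by
      intro h
      refine hW.eigenvectorBasis.toBasis.ne_zero i ?_
      rw [OrthonormalBasis.coe_toBasis]
      ext j
      exact congrFun h j
    have hq := hMpd.dotProduct_mulVec_pos hne
    have e : M *ᵥ ⇑(hW.eigenvectorBasis i)
        = ((1 + hW.eigenvalues i : ℝ) : ℂ) • (⇑(hW.eigenvectorBasis i) : n → ℂ) := by
      rw [sub_mulVec, one_mulVec, sub_eq_iff_eq_add] at hv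
      rw [hv]
      ext j
      simp [add_mul, add_comm]
    rw [e, dotProduct_smul, smul_eq_mul] at hq
    have hn : (0 : ℂ) < star (⇑(hW.eigenvectorBasis i) : n → ℂ) ⬝ᵥ
        (⇑(hW.eigenvectorBasis i) : n → ℂ) := dotProduct_star_self_pos_iff.2 hne
    have := (pos_iff_pos_of_mul_pos hq).2 hn
    exact_mod_cast this
  have hpos' : ∀ i, 0 < 1 + δ * hW.eigenvalues i := by
    intro i
    have := hpos i
    rcases eq_or_lt_of_le h0 with h | h
    · rw [← h]; norm_num
    · nlinarith
  have hB' := hdet 1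
  rw [one_smul, sub_self, zero_smul, add_zero] at hB'
  simp only [one_mul] at hB'
  have lA := (det_re_pos hA).ne'
  rw [hdet, hB', Real.log_mul lA (Finset.prod_pos fun i _ => hpos i).ne',
    Real.log_mul lA (Finset.prod_pos fun i _ => hpos' i).ne',
    Real.log_prod (fun i _ => (hpos i).ne'), Real.log_prod (fun i _ => (hpos' i).ne')]
  have : δ * ∑ i, Real.log (1 + hW.eigenvalues i)
      ≤ ∑ i, Real.log (1 + δ * hW.eigenvalues i) := by
    rw [Finset.mul_sum]
    refine Finset.sum_le_sum fun i _ => ?_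
    -- Concavity of the scalar logarithm between `1`, where it vanishes, and `1 + λ`.
    have hc := strictConcaveOn_log_Ioi.concaveOn.2 (Set.mem_Ioi.2 one_pos)
      (Set.mem_Ioi.2 (hpos i)) (sub_nonneg.2 h1) h0 (by ring)
    simp only [smul_eq_mul, Real.log_one, mul_zero, zero_add] at hc
    refine hc.trans_eq ?_
    congr 1; ring
  linarith

end MatrixFacts

/-! ### Greedy vertices of a submodular set function. -/

section Polymatroid

variable {K : ℕ}

lemma prevWeight_zero {n : ℕ} (v : Fin (n + 1) → ℝ) : prevWeight v 0 = 0 := by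
  simp [prevWeight]

lemma prevWeight_succ {n : ℕ} (v : Fin (n + 1) → ℝ) (i : Fin n) :
    prevWeight v i.succ = v i.castSucc := by
  simp [prevWeight]; rfl

lemma Ici_succ_eq_Ioi_castSucc {n : ℕ} (i : Fin n) :
    Finset.Ici i.succ = Finset.Ioi i.castSucc := by
  ext j
  rw [Finset.mem_Ici, Finset.mem_Ioi, Fin.castSucc_lt_iff_succ_le]

lemma Ioi_last_eq_empty {n : ℕ} : Finset.Ioi (Fin.last n) = ∅ := by
  ext j
  simp [Fin.le_last]

lemma Ici_zero_eq_univ {n : ℕ} : Finset.Ici (0 : Fin (n + 1)) = Finset.univ := by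
  ext j
  simp

/-- Abel summation: `Ioi j` is `Ici` of the next position, and `hf` removes the boundary term. -/
lemma sum_mul_Ici_sub_Ioi (v : Fin K → ℝ) (f : Finset (Fin K) → ℝ) (hf : f ∅ = 0) :
    ∑ j, v j * (f (Finset.Ici j) - f (Finset.Ioi j))
      = ∑ j, (v j - prevWeight v j) * f (Finset.Ici j) := by
  cases K with
  | zero => simp
  | succ n =>
    simp only [mul_sub, sub_mul, Finset.sum_sub_distrib]
    congr 1
    rw [Fin.sum_univ_castSucc, Fin.sum_univ_succ, Ioi_last_eq_empty, hf, prevWeight_zero]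
    simp only [prevWeight_succ, Ici_succ_eq_Ioi_castSucc]
    ring

lemma sum_Ici_sub_Ioi (f : Finset (Fin K) → ℝ) (hf : f ∅ = 0) :
    ∑ j, (f (Finset.Ici j) - f (Finset.Ioi j)) = f Finset.univ := by
  cases K with
  | zero => simp [Finset.univ_eq_empty, hf]
  | succ n =>
    rw [Finset.sum_sub_distrib, Fin.sum_univ_succ, Fin.sum_univ_castSucc, Ioi_last_eq_empty, hf,
      Ici_zero_eq_univ]
    simp only [Ici_succ_eq_Ioi_castSucc]
    ring

/-- The increment of the set function `φ` when user `k` joins the users decoded after it. -/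
def marginal (φ : Finset (Fin K) → ℝ) (π : Equiv.Perm (Fin K)) (k : Fin K) : ℝ :=
  φ ((Finset.Ici (π.symm k)).map π.toEmbedding) - φ ((Finset.Ioi (π.symm k)).map π.toEmbedding)

lemma map_Ici_eq_insert (π : Equiv.Perm (Fin K)) (j : Fin K) :
    (Finset.Ici j).map π.toEmbedding = insert (π j) ((Finset.Ioi j).map π.toEmbedding) := by
  rw [← Finset.Ioi_insert, Finset.map_insert]; rfl

lemma not_mem_map_Ioi (π : Equiv.Perm (Fin K)) (j : Fin K) :
    π j ∉ (Finset.Ioi j).map π.toEmbedding := by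
  simp

lemma sum_marginal_univ {φ : Finset (Fin K) → ℝ} (h0 : φ ∅ = 0) (π : Equiv.Perm (Fin K)) :
    ∑ k, marginal φ π k = φ Finset.univ := by
  rw [← Equiv.sum_comp π]
  simp only [marginal, Equiv.symm_apply_apply]
  rw [sum_Ici_sub_Ioi (fun S => φ (S.map π.toEmbedding)) (by simpa using h0)]
  simp

/-- Intersecting the later users with `S` shrinks the base set, so by submodularity it can only
raise the increment of a user in `S`; the raised increments telescope. -/
lemma sum_marginal_le {φ : Finset (Fin K) → ℝ} (h0 : φ ∅ = 0)
    (hφ : ∀ A B k, A ⊆ B → k ∉ B → φ (insert k B) - φ B ≤ φ (insert k A) - φ A)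
    (π : Equiv.Perm (Fin K)) (S : Finset (Fin K)) :
    ∑ k ∈ S, marginal φ π k ≤ φ S := by
  have key : ∀ j, (if π j ∈ S then marginal φ π (π j) else 0)
      ≤ φ ((Finset.Ici j).map π.toEmbedding ∩ S) - φ ((Finset.Ioi j).map π.toEmbedding ∩ S) := by
    intro j
    rw [map_Ici_eq_insert]
    split_ifs with h
    · rw [Finset.insert_inter_of_mem h, marginal, Equiv.symm_apply_apply, map_Ici_eq_insert]
      exact hφ _ _ _ Finset.inter_subset_left (not_mem_map_Ioi π j)
    · rw [Finset.insert_inter_of_notMem h, sub_self]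
  calc ∑ k ∈ S, marginal φ π k = ∑ k, if k ∈ S then marginal φ π k else 0 := by
        simp
    _ = ∑ j, if π j ∈ S then marginal φ π (π j) else 0 :=
        (Equiv.sum_comp π (fun k => if k ∈ S then marginal φ π k else 0)).symm
    _ ≤ _ := Finset.sum_le_sum fun j _ => key j
    _ = φ S := by
        rw [sum_Ici_sub_Ioi (fun A => φ (A.map π.toEmbedding ∩ S)) (by simpa using h0)]
        simp

lemma sum_mul_marginal_eq {φ : Finset (Fin K) → ℝ} (h0 : φ ∅ = 0) (w : Fin K → ℝ)
    (π : Equiv.Perm (Fin K)) :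
    ∑ k, w k * marginal φ π k
      = ∑ j, (w (π j) - prevWeight (fun i => w (π i)) j)
          * φ ((Finset.Ici j).map π.toEmbedding) := by
  rw [← Equiv.sum_comp π]
  simp only [marginal, Equiv.symm_apply_apply]
  exact sum_mul_Ici_sub_Ioi (fun j => w (π j)) (fun S => φ (S.map π.toEmbedding))
    (by simpa using h0)

/-- Edmonds' greedy algorithm: for a submodular function, an order with nondecreasing weights
maximizes the weighted sum of the marginals. -/
lemma sum_mul_marginal_le {φ : Finset (Fin K) → ℝ} (h0 : φ ∅ = 0)
    (hφ : ∀ A B k, A ⊆ B → k ∉ B → φ (insert k B) - φ B ≤ φ (insert k A) - φ A)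
    {w : Fin K → ℝ} {π : Equiv.Perm (Fin K)} (hπ : Monotone fun j => w (π j))
    (π' : Equiv.Perm (Fin K)) :
    ∑ k, w k * marginal φ π' k ≤ ∑ k, w k * marginal φ π k := by
  -- The marginals for `π'` are those of the modular function they sum to, whatever the order, so
  -- Abel summation in the order `π` applies.
  have e : ∑ k, w k * marginal φ π' k
      = ∑ j, (w (π j) - prevWeight (fun i => w (π i)) j)
          * ∑ k ∈ (Finset.Ici j).map π.toEmbedding, marginal φ π' k := by
    have h := sum_mul_marginal_eq (φ := fun S => ∑ k ∈ S, marginal φ π' k) (by simp) w π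
    rw [← h]
    refine Finset.sum_congr rfl fun k _ => ?_
    obtain ⟨j, rfl⟩ := π.surjective k
    rw [marginal.eq_def (fun S => ∑ k ∈ S, marginal φ π' k), Equiv.symm_apply_apply,
      map_Ici_eq_insert, Finset.sum_insert (not_mem_map_Ioi π j)]
    ring
  rw [e, sum_mul_marginal_eq h0 w π]
  refine Finset.sum_le_sum fun j _ => ?_
  cases K with
  | zero => exact j.elim0
  | succ n =>
    induction j using Fin.cases with
    | zero =>
      -- This coefficient is the smallest weight and may be negative; equality of the totals over
      -- all users is used instead of a bound.
      rw [Ici_zero_eq_univ]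
      simp only [Finset.map_univ_equiv]
      rw [sum_marginal_univ h0]
    | succ i =>
      refine mul_le_mul_of_nonneg_left (sum_marginal_le h0 hφ _ _) ?_
      rw [prevWeight_succ, sub_nonneg]
      exact hπ (Fin.castSucc_lt_succ).le

end Polymatroid

/-! ### Rates as marginals, and concavity of the sorted objective. -/

section Rates

variable {K NR : ℕ} {N : Fin K → ℕ}

/-- The covariance of the noise plus the signals of the users in `S`. -/
noncomputable def sumCov (H : Channel NR N) (Q : CompCov N) (S : Finset (Fin K)) :
    Matrix (Fin NR) (Fin NR) ℂ :=
  1 + ∑ k ∈ S, H k * Q k * (H k).conjTranspose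

/-- The sum rate of the users in `S` when they are decoded without interference. -/
noncomputable def sumRate (H : Channel NR N) (Q : CompCov N) (S : Finset (Fin K)) : ℝ :=
  Real.log (sumCov H Q S).det.re

lemma sigDet_eq (H : Channel NR N) (Q : CompCov N) (π : Equiv.Perm (Fin K))
    (S : Finset (Fin K)) : sigDet H Q π S = (sumCov H Q (S.map π.toEmbedding)).det.re := by
  simp [sigDet, sumCov]

lemma posSemidef_sum_signal (H : Channel NR N) {Q : CompCov N} (hQ : ∀ k, (Q k).PosSemidef)
    (S : Finset (Fin K)) : (∑ k ∈ S, H k * Q k * (H k).conjTranspose).PosSemidef :=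
  Matrix.posSemidef_sum S fun k _ => (hQ k).mul_mul_conjTranspose_same (H k)

lemma posDef_sumCov (H : Channel NR N) {Q : CompCov N} (hQ : ∀ k, (Q k).PosSemidef)
    (S : Finset (Fin K)) : (sumCov H Q S).PosDef :=
  Matrix.PosDef.one.add_posSemidef (posSemidef_sum_signal H hQ S)

lemma sigDet_pos (H : Channel NR N) {Q : CompCov N} (hQ : ∀ k, (Q k).PosSemidef)
    (π : Equiv.Perm (Fin K)) (S : Finset (Fin K)) : 0 < sigDet H Q π S := by
  rw [sigDet_eq]; exact det_re_pos (posDef_sumCov H hQ _)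

lemma sumRate_empty (H : Channel NR N) (Q : CompCov N) : sumRate H Q ∅ = 0 := by
  simp [sumRate, sumCov]

lemma rate_eq_marginal (H : Channel NR N) {Q : CompCov N} (hQ : ∀ k, (Q k).PosSemidef)
    (π : Equiv.Perm (Fin K)) (k : Fin K) : rate H π k Q = marginal (sumRate H Q) π k := by
  rw [rate, Real.log_div (sigDet_pos H hQ _ _).ne' (sigDet_pos H hQ _ _).ne', sigDet_eq, sigDet_eq]
  rfl

lemma sumRate_submodular (H : Channel NR N) {Q : CompCov N} (hQ : ∀ k, (Q k).PosSemidef)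
    (A B : Finset (Fin K)) (k : Fin K) (hAB : A ⊆ B) (hk : k ∉ B) :
    sumRate H Q (insert k B) - sumRate H Q B ≤ sumRate H Q (insert k A) - sumRate H Q A := by
  have hins : ∀ {S : Finset (Fin K)}, k ∉ S →
      sumCov H Q (insert k S) = sumCov H Q S + H k * Q k * (H k).conjTranspose := by
    intro S hS
    rw [sumCov, Finset.sum_insert hS, sumCov]; abel
  have hB : sumCov H Q B
      = sumCov H Q A + ∑ k ∈ B \ A, H k * Q k * (H k).conjTranspose := by
    rw [sumCov, ← Finset.sum_sdiff hAB, sumCov]; abel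
  simp only [sumRate]
  rw [hins hk, hins fun h => hk (hAB h), hB]
  exact log_det_add_sub_le (posDef_sumCov H hQ A) (posSemidef_sum_signal H hQ _)
    ((hQ k).mul_mul_conjTranspose_same (H k))

lemma covObjective_eq (H : Channel NR N) {Q : CompCov N} (hQ : ∀ k, (Q k).PosSemidef)
    (w : Fin K → ℝ) (π : Equiv.Perm (Fin K)) :
    covObjective H w π Q = ∑ k, w k * rate H π k Q := by
  simp only [rate_eq_marginal H hQ]
  rw [sum_mul_marginal_eq (sumRate_empty H Q), covObjective]
  simp only [sigDet_eq]
  rfl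

/-- The greedy algorithm for `sumRate`. Weights of any sign are allowed, as the perturbed weights of
the separation argument require. -/
lemma isOptimalOrder_of_monotone (H : Channel NR N) {P : Set (CompCov N)}
    (hP : ∀ Q ∈ P, ∀ k, (Q k).PosSemidef) {w : Fin K → ℝ} {π : Equiv.Perm (Fin K)}
    (hπ : Monotone fun j => w (π j)) : IsOptimalOrder H P w π := by
  intro Q hQ π'
  simp only [rate_eq_marginal H (hP Q hQ)]
  exact sum_mul_marginal_le (sumRate_empty H Q) (sumRate_submodular H (hP Q hQ)) hπ π'

lemma prevWeight_le {w : Fin K → ℝ} (hw : ∀ k, 0 ≤ w k) {π : Equiv.Perm (Fin K)}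
    (hπ : Monotone fun j => w (π j)) (j : Fin K) :
    prevWeight (fun i => w (π i)) j ≤ w (π j) := by
  cases K with
  | zero => exact j.elim0
  | succ n =>
    induction j using Fin.cases with
    | zero => rw [prevWeight_zero]; exact hw _
    | succ i => rw [prevWeight_succ]; exact hπ (Fin.castSucc_lt_succ).le

lemma sumCov_segment (H : Channel NR N) (Q Q' : CompCov N) (S : Finset (Fin K)) (δ : ℝ) :
    sumCov H (δ • Q' + (1 - δ) • Q) S = δ • sumCov H Q' S + (1 - δ) • sumCov H Q S := by
  have e : (1 : Matrix (Fin NR) (Fin NR) ℂ) = δ • 1 + (1 - δ) • 1 := by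
    rw [← add_smul]; simp
  simp only [sumCov, smul_add]
  conv_lhs => rw [e]
  simp only [Pi.add_apply, Pi.smul_apply, Matrix.mul_add, Matrix.add_mul, Finset.sum_add_distrib,
    Matrix.mul_smul, Matrix.smul_mul, Finset.smul_sum]
  abel

/-- Sorted nonnegative weights make every coefficient, the first included, nonnegative; the
covariances are affine along the segment. -/
lemma covObjective_concave (H : Channel NR N) {w : Fin K → ℝ} (hw : ∀ k, 0 ≤ w k)
    {π : Equiv.Perm (Fin K)} (hπ : Monotone fun j => w (π j)) {Q Q' : CompCov N}
    (hQ : ∀ k, (Q k).PosSemidef) (hQ' : ∀ k, (Q' k).PosSemidef) {δ : ℝ} (h0 : 0 ≤ δ)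
    (h1 : δ ≤ 1) :
    (1 - δ) * covObjective H w π Q + δ * covObjective H w π Q'
      ≤ covObjective H w π (δ • Q' + (1 - δ) • Q) := by
  simp only [covObjective, sigDet_eq, Finset.mul_sum]
  rw [← Finset.sum_add_distrib]
  refine Finset.sum_le_sum fun j _ => ?_
  rw [sumCov_segment]
  have h := mul_le_mul_of_nonneg_left
    (log_det_concave (posDef_sumCov H hQ ((Finset.Ici j).map π.toEmbedding))
      (posDef_sumCov H hQ' ((Finset.Ici j).map π.toEmbedding)) h0 h1)
    (sub_nonneg.2 (prevWeight_le hw hπ j))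
  refine le_trans (le_of_eq ?_) h
  ring

end Rates

/-! ### Smoothness of the rates. -/

section Smoothness

variable {K NR : ℕ} {N : Fin K → ℕ}

attribute [local instance] Matrix.normedAddCommGroup Matrix.normedSpace

lemma contDiff_sigDet (H : Channel NR N) (π : Equiv.Perm (Fin K)) (S : Finset (Fin K)) :
    ContDiff ℝ 1 (fun Q : CompCov N => sigDet H Q π S) := by
  have hentry : ∀ a b, ContDiff ℝ 1 (fun Q : CompCov N =>
      (1 + ∑ j ∈ S, H (π j) * Q (π j) * (H (π j)).conjTranspose) a b) := by
    intro a b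
    simp only [Matrix.add_apply, Matrix.sum_apply, Matrix.mul_apply]
    refine contDiff_const.add (ContDiff.sum fun j _ => ContDiff.sum fun c _ => ?_)
    refine ContDiff.mul (ContDiff.sum fun d _ => contDiff_const.mul ?_) contDiff_const
    exact (contDiff_apply_apply ℝ ℂ d c).comp (contDiff_pi.1 contDiff_id (π j))
  unfold sigDet
  simp only [Matrix.det_apply]
  refine Complex.reCLM.contDiff.comp (ContDiff.sum fun τ _ => ?_)
  refine ContDiff.const_smul _ (contDiff_prod fun i _ => hentry _ _)

/-- The composite matrices at which all the rates are smooth. -/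
def smoothSet (H : Channel NR N) : Set (CompCov N) :=
  {Q | ∀ (π : Equiv.Perm (Fin K)) (S : Finset (Fin K)), 0 < sigDet H Q π S}

/-- Derivatives are taken among all complex blocks, where the positive semidefinite ones are in
general not open; this set is an open neighbourhood of them. -/
lemma isOpen_smoothSet (H : Channel NR N) : IsOpen (smoothSet H) := by
  simp only [smoothSet, Set.ofPred_forall]
  exact isOpen_iInter_of_finite fun π => isOpen_iInter_of_finite fun S =>
    isOpen_lt continuous_const (contDiff_sigDet H π S).continuous

lemma contDiffOn_rate (H : Channel NR N) (π : Equiv.Perm (Fin K)) (k : Fin K) :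
    ContDiffOn ℝ 1 (rate H π k) (smoothSet H) := by
  intro Q hQ
  refine ContDiffAt.contDiffWithinAt ?_
  unfold rate
  exact ((contDiff_sigDet H π _).contDiffAt.div (contDiff_sigDet H π _).contDiffAt
    (hQ _ _).ne').log (div_pos (hQ _ _) (hQ _ _)).ne'

end Smoothness

/-! ### Derivatives along feasible segments. -/

section Derivatives

variable {K NR : ℕ} {N : Fin K → ℕ}

attribute [local instance] Matrix.normedAddCommGroup Matrix.normedSpace

/-- Feasible segments extend only to the right of `0`, and right slopes already determine the
derivative. -/
lemma le_deriv_of_le {ψ : ℝ → ℝ} {c d : ℝ} (hd : HasDerivAt ψ d 0)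
    (h : ∀ᶠ δ in 𝓝[>] (0 : ℝ), ψ 0 + δ * c ≤ ψ δ) : c ≤ d := by
  refine ge_of_tendsto hd.tendsto_slope_zero_right ?_
  filter_upwards [h, self_mem_nhdsWithin] with δ hδ hpos
  rw [zero_add, smul_eq_mul, inv_mul_eq_div, le_div_iff₀ hpos]
  linarith

lemma dual_apply_eq_sum (l : (Fin K → ℝ) →L[ℝ] ℝ) (y : Fin K → ℝ) :
    l y = ∑ k, l (Pi.single k 1) * y k := by
  conv_lhs => rw [pi_eq_sum_univ' y]
  rw [map_sum]
  exact Finset.sum_congr rfl fun k _ => by rw [map_smul, smul_eq_mul, mul_comm]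

lemma fderiv_apply_eq_neg_sum (f : (Fin K → ℝ) → ℝ) (x y : Fin K → ℝ) :
    fderiv ℝ f x y = -∑ k, weights f x k * y k := by
  rw [dual_apply_eq_sum, ← Finset.sum_neg_distrib]
  exact Finset.sum_congr rfl fun k _ => by rw [weights]; ring

lemma hasDerivAt_segment {E : Type*} [NormedAddCommGroup E] [NormedSpace ℝ E] (x y : E) (δ : ℝ) :
    HasDerivAt (fun δ : ℝ => δ • y + (1 - δ) • x) (y - x) δ := by
  have h : HasDerivAt (fun δ : ℝ => δ • y + (1 - δ) • x) ((1 : ℝ) • y + (-1 : ℝ) • x) δ :=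
    ((hasDerivAt_id δ).smul_const y).add (((hasDerivAt_id δ).const_sub 1).smul_const x)
  rwa [one_smul, neg_one_smul, ← sub_eq_add_neg] at h

lemma fderiv_sub_le_sub {f : (Fin K → ℝ) → ℝ} {U : Set (Fin K → ℝ)} (hf : ConvexOn ℝ U f)
    {x y : Fin K → ℝ} (hx : x ∈ U) (hy : y ∈ U) (hfx : DifferentiableAt ℝ f x) :
    fderiv ℝ f x (y - x) ≤ f y - f x := by
  have h0 : (fun δ : ℝ => δ • y + (1 - δ) • x) 0 = x := by simp
  have hd : HasDerivAt (fun δ : ℝ => -f (δ • y + (1 - δ) • x)) (-fderiv ℝ f x (y - x)) 0 := by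
    have hfx' : HasFDerivAt f (fderiv ℝ f x) ((fun δ : ℝ => δ • y + (1 - δ) • x) 0) := by
      rw [h0]; exact hfx.hasFDerivAt
    exact (hfx'.comp_hasDerivAt 0 (hasDerivAt_segment x y 0)).neg
  have := le_deriv_of_le (c := -(f y - f x)) hd <| by
    filter_upwards [Ioo_mem_nhdsGT (zero_lt_one' ℝ)] with δ hδ
    have := hf.2 hy hx hδ.1.le (sub_nonneg.2 hδ.2.le) (by ring)
    simp only [smul_eq_mul, zero_smul, sub_zero, one_smul, zero_add] at this ⊢
    linarith
  linarith

/-- The derivative of the rate vector with respect to the covariances, in direction `D`. -/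
noncomputable def rateVecDeriv (H : Channel NR N) (β : Equiv.Perm (Fin K) → ℝ)
    (Q D : CompCov N) : Fin K → ℝ :=
  fun k => ∑ π, β π * fderiv ℝ (rate H π k) Q D

lemma mem_smoothSet (H : Channel NR N) {Q : CompCov N} (hQ : ∀ k, (Q k).PosSemidef) :
    Q ∈ smoothSet H := fun π S => sigDet_pos H hQ π S

lemma hasDerivAt_rateVec_segment (H : Channel NR N) (β : Equiv.Perm (Fin K) → ℝ)
    (Q Q' : CompCov N) {δ : ℝ} (hδ : δ • Q' + (1 - δ) • Q ∈ smoothSet H) :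
    HasDerivAt (fun δ : ℝ => rateVec H β (δ • Q' + (1 - δ) • Q))
      (rateVecDeriv H β (δ • Q' + (1 - δ) • Q) (Q' - Q)) δ := by
  refine hasDerivAt_pi.2 fun k => ?_
  refine HasDerivAt.fun_sum fun π _ => HasDerivAt.const_mul _ ?_
  have hd : HasFDerivAt (rate H π k) (fderiv ℝ (rate H π k) (δ • Q' + (1 - δ) • Q))
      (δ • Q' + (1 - δ) • Q) :=
    (((contDiffOn_rate H π k).contDiffAt ((isOpen_smoothSet H).mem_nhds hδ)).differentiableAt
      one_ne_zero).hasFDerivAt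
  exact hd.comp_hasDerivAt δ (hasDerivAt_segment Q Q' δ)

lemma hasDerivAt_lineObjective (H : Channel NR N) {f : (Fin K → ℝ) → ℝ}
    (β : Equiv.Perm (Fin K) → ℝ) (Q Q' : CompCov N) {δ : ℝ}
    (hδ : δ • Q' + (1 - δ) • Q ∈ smoothSet H)
    (hf : DifferentiableAt ℝ f (rateVec H β (δ • Q' + (1 - δ) • Q))) :
    HasDerivAt (lineObjective H f β Q Q')
      (fderiv ℝ f (rateVec H β (δ • Q' + (1 - δ) • Q))
        (rateVecDeriv H β (δ • Q' + (1 - δ) • Q) (Q' - Q))) δ :=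
  hf.hasFDerivAt.comp_hasDerivAt δ (hasDerivAt_rateVec_segment H β Q Q' hδ)

lemma continuousOn_rate (H : Channel NR N) (π : Equiv.Perm (Fin K)) (k : Fin K) :
    ContinuousOn (rate H π k) (smoothSet H) := (contDiffOn_rate H π k).continuousOn

lemma continuousOn_rateVec (H : Channel NR N) :
    ContinuousOn (fun p : (Equiv.Perm (Fin K) → ℝ) × CompCov N => rateVec H p.1 p.2)
      (Set.univ ×ˢ smoothSet H) := by
  refine continuousOn_pi.2 fun k => continuousOn_finsetSum _ fun π _ => ?_
  refine ContinuousOn.mul (by fun_prop) ?_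
  exact (continuousOn_rate H π k).comp continuousOn_snd fun p hp => hp.2

lemma continuousOn_rateVecDeriv (H : Channel NR N) :
    ContinuousOn (fun p : (Equiv.Perm (Fin K) → ℝ) × CompCov N × CompCov N =>
      rateVecDeriv H p.1 p.2.1 p.2.2) {p | p.2.1 ∈ smoothSet H} := by
  refine continuousOn_pi.2 fun k => continuousOn_finsetSum _ fun π _ => ?_
  refine ContinuousOn.mul (by fun_prop) (ContinuousOn.clm_apply ?_ (by fun_prop))
  exact ((contDiffOn_rate H π k).continuousOn_fderiv_of_isOpen (isOpen_smoothSet H) le_rfl).comp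
    (by fun_prop) fun p hp => hp

/-- Along the feasible segments the objective is differentiable at the origin, uniformly. -/
lemma exists_lineObjective_le (H : Channel NR N) {P : Set (CompCov N)} {f : (Fin K → ℝ) → ℝ}
    {U : Set (Fin K → ℝ)} (hP : ∀ Q ∈ P, ∀ k, (Q k).PosSemidef) (hPcompact : IsCompact P)
    (hPconvex : Convex ℝ P) (hUopen : IsOpen U)
    (hUrates : ∀ β ∈ stdSimplex ℝ (Equiv.Perm (Fin K)), ∀ Q ∈ P, rateVec H β Q ∈ U)
    (hf : DifferentiableOn ℝ f U) (hf' : ContinuousOn (fderiv ℝ f) U) {η : ℝ} (hη : 0 < η) :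
    ∃ δ₀ > 0, ∀ β ∈ stdSimplex ℝ (Equiv.Perm (Fin K)), ∀ Q ∈ P, ∀ Q' ∈ P, ∀ δ : ℝ,
      0 < δ → δ ≤ δ₀ → δ ≤ 1 →
      lineObjective H f β Q Q' δ
        ≤ lineObjective H f β Q Q' 0 + δ * (deriv (lineObjective H f β Q Q') 0 + η) := by
  set C : Set ((Equiv.Perm (Fin K) → ℝ) × CompCov N × CompCov N × ℝ) :=
    stdSimplex ℝ (Equiv.Perm (Fin K)) ×ˢ P ×ˢ P ×ˢ Set.Icc (0 : ℝ) 1 with hC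
  have hCc : IsCompact C := (isCompact_stdSimplex ℝ _).prod
    (hPcompact.prod (hPcompact.prod isCompact_Icc))
  set s : (Equiv.Perm (Fin K) → ℝ) × CompCov N × CompCov N × ℝ → CompCov N :=
    fun p => p.2.2.2 • p.2.2.1 + (1 - p.2.2.2) • p.2.1 with hs
  have hscont : Continuous s := by fun_prop
  have hsP : ∀ p ∈ C, s p ∈ P := by
    rintro ⟨β, Q, Q', δ⟩ ⟨-, hQ, hQ', hδ⟩
    exact hPconvex hQ' hQ hδ.1 (sub_nonneg.2 hδ.2) (by ring)
  have hsm : ∀ p ∈ C, s p ∈ smoothSet H := fun p hp => mem_smoothSet H (hP _ (hsP p hp))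
  -- The slope of the objective as a function of all data at once. Uniform continuity on the compact
  -- `C` and the mean value theorem give one `δ₀` for all segments.
  set G : (Equiv.Perm (Fin K) → ℝ) × CompCov N × CompCov N × ℝ → ℝ := fun p =>
    fderiv ℝ f (rateVec H p.1 (s p)) (rateVecDeriv H p.1 (s p) (p.2.2.1 - p.2.1)) with hG
  have hGcont : ContinuousOn G C := by
    refine ContinuousOn.clm_apply ?_ ?_
    · have hr : ContinuousOn (fun p => rateVec H p.1 (s p)) C :=
        (continuousOn_rateVec H).comp (f :=
          fun p : (Equiv.Perm (Fin K) → ℝ) × CompCov N × CompCov N × ℝ => (p.1, s p)) (by fun_prop)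
          fun p hp => ⟨trivial, hsm p hp⟩
      exact hf'.comp hr fun p hp => hUrates _ hp.1 _ (hsP p hp)
    · exact (continuousOn_rateVecDeriv H).comp
        (f := fun p => (p.1, s p, p.2.2.1 - p.2.1)) (by fun_prop) fun p hp => hsm p hp
  obtain ⟨δ₀, hδ₀, hunif⟩ := Metric.uniformContinuousOn_iff.1
    (hCc.uniformContinuousOn_of_continuous hGcont) η hη
  refine ⟨δ₀ / 2, half_pos hδ₀, fun β hβ Q hQ Q' hQ' δ hδ hδle hδ1 => ?_⟩
  have hderiv : ∀ τ ∈ Set.Icc (0 : ℝ) 1,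
      HasDerivAt (lineObjective H f β Q Q') (G (β, Q, Q', τ)) τ := by
    intro τ hτ
    have hmem : (β, Q, Q', τ) ∈ C := ⟨hβ, hQ, hQ', hτ⟩
    exact hasDerivAt_lineObjective H β Q Q' (hsm _ hmem)
      (hf.differentiableAt (hUopen.mem_nhds (hUrates _ hβ _ (hsP _ hmem))))
  have h01 : (0 : ℝ) ∈ Set.Icc (0 : ℝ) 1 := ⟨le_rfl, zero_le_one⟩
  obtain ⟨ξ, hξ, hslope⟩ := exists_hasDerivAt_eq_slope (lineObjective H f β Q Q')
    (fun τ => G (β, Q, Q', τ)) hδ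
    (fun τ hτ => (hderiv τ ⟨hτ.1, hτ.2.trans hδ1⟩).continuousAt.continuousWithinAt)
    (fun τ hτ => hderiv τ ⟨hτ.1.le, hτ.2.le.trans hδ1⟩)
  have hξ1 : ξ ∈ Set.Icc (0 : ℝ) 1 := ⟨hξ.1.le, hξ.2.le.trans hδ1⟩
  have hclose := hunif (β, Q, Q', ξ) ⟨hβ, hQ, hQ', hξ1⟩ (β, Q, Q', 0) ⟨hβ, hQ, hQ', h01⟩ (by
    simp only [Prod.dist_eq, dist_self, Real.dist_eq, sub_zero, abs_of_pos hξ.1]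
    simp only [max_lt_iff]
    refine ⟨hδ₀, hδ₀, hδ₀, ?_⟩
    linarith [hξ.2])
  rw [Real.dist_eq] at hclose
  have hle := (abs_lt.1 hclose).2.le
  rw [(hderiv 0 h01).deriv]
  rw [sub_zero, eq_div_iff hδ.ne'] at hslope
  nlinarith

end Derivatives

/-! ### Time-sharing with optimum orders only. -/

section TimeSharing

variable {K NR : ℕ} {N : Fin K → ℕ}

lemma sum_mul_rateVec (H : Channel NR N) (v : Fin K → ℝ) (β : Equiv.Perm (Fin K) → ℝ)
    (Q : CompCov N) :
    ∑ k, v k * rateVec H β Q k = ∑ π, β π * ∑ k, v k * rate H π k Q := by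
  simp only [rateVec, Finset.mul_sum]
  rw [Finset.sum_comm]
  exact Finset.sum_congr rfl fun _ _ => Finset.sum_congr rfl fun _ _ => by ring

lemma sum_simplex_mul_le {ι : Type*} [Fintype ι] {β a : ι → ℝ} {c : ℝ}
    (hβ : β ∈ stdSimplex ℝ ι) (ha : ∀ i, a i ≤ c) : ∑ i, β i * a i ≤ c := by
  calc ∑ i, β i * a i ≤ ∑ i, β i * c :=
        Finset.sum_le_sum fun i _ => mul_le_mul_of_nonneg_left (ha i) (hβ.1 i)
    _ = c := by rw [← Finset.sum_mul, hβ.2, one_mul]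

lemma rateVec_single (H : Channel NR N) (π : Equiv.Perm (Fin K)) (Q : CompCov N) :
    rateVec H (Pi.single π 1) Q = fun k => rate H π k Q := by
  ext k
  simp [rateVec, Pi.single_apply]

lemma rateVec_add_smul (H : Channel NR N) (β β' : Equiv.Perm (Fin K) → ℝ) (a b : ℝ)
    (Q : CompCov N) :
    rateVec H (a • β + b • β') Q = a • rateVec H β Q + b • rateVec H β' Q := by
  ext k
  simp [rateVec, Finset.mul_sum, add_mul, Finset.sum_add_distrib, mul_assoc]

/-- A refinement of `w` by a small multiple of `v` is sorted by an order that also sorts `w`. -/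
lemma exists_monotone_perturbation (w v : Fin K → ℝ) :
    ∃ ε > 0, ∀ π : Equiv.Perm (Fin K), Monotone (fun j => w (π j) + ε * v (π j)) →
      Monotone fun j => w (π j) := by
  -- Only finitely many strict inequalities have to survive the perturbation.
  have hev : ∀ᶠ ε in 𝓝[>] (0 : ℝ), ∀ i j, w i < w j → w i + ε * v i < w j + ε * v j := by
    refine eventually_all.2 fun i => eventually_all.2 fun j => ?_
    by_cases h : w i < w j
    · have hc : ∀ i, Tendsto (fun ε : ℝ => w i + ε * v i) (𝓝[>] 0) (𝓝 (w i)) := by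
        intro i
        have : Continuous fun ε : ℝ => w i + ε * v i := by fun_prop
        have h := this.tendsto 0
        simp only [zero_mul, add_zero] at h
        exact h.mono_left nhdsWithin_le_nhds
      filter_upwards [(hc i).eventually_lt (hc j) h] with ε hε _ using hε
    · exact Eventually.of_forall fun _ h' => absurd h' h
  obtain ⟨ε, hε, hpos⟩ := (hev.and self_mem_nhdsWithin).exists
  refine ⟨ε, hpos, fun π hπ a b hab => ?_⟩
  by_contra hlt
  exact (hε _ _ (not_le.1 hlt)).not_ge (hπ hab)

/-- Were the rate vector outside the hull `T` of the vertices of sorting orders, some `v` would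
separate it from `T`. An order sorting `w + ε * v` also sorts `w`, so its vertex lies in `T`:
strictly worse for `v`, no better for `w` by `hw`, yet optimum for `w + ε * v`. -/
lemma exists_simplex_monotone_rateVec_eq (H : Channel NR N) {Q : CompCov N}
    (hQ : ∀ k, (Q k).PosSemidef) {β : Equiv.Perm (Fin K) → ℝ}
    (hβ : β ∈ stdSimplex ℝ (Equiv.Perm (Fin K))) {w : Fin K → ℝ}
    (hw : ∀ π, ∑ k, w k * rate H π k Q ≤ ∑ k, w k * rateVec H β Q k) :
    ∃ β' ∈ stdSimplex ℝ (Equiv.Perm (Fin K)), rateVec H β' Q = rateVec H β Q ∧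
      ∀ π, 0 < β' π → Monotone fun j => w (π j) := by
  set F : Set (Equiv.Perm (Fin K) → ℝ) := stdSimplex ℝ (Equiv.Perm (Fin K)) ∩
    {β' | ∀ π, ¬ Monotone (fun j => w (π j)) → β' π = 0} with hF
  have hFclosed : IsClosed {β' : Equiv.Perm (Fin K) → ℝ |
      ∀ π, ¬ Monotone (fun j => w (π j)) → β' π = 0} := by
    simp only [Set.ofPred_forall]
    exact isClosed_iInter fun π => isClosed_iInter fun _ =>
      isClosed_eq (continuous_apply π) continuous_const
  have hFcompact : IsCompact F := (isCompact_stdSimplex ℝ _).inter_right hFclosed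
  have hFconvex : Convex ℝ F := by
    refine (convex_stdSimplex ℝ _).inter ?_
    intro b hb c hc s t _ _ _ π hπ
    simp [hb π hπ, hc π hπ]
  set T : Set (Fin K → ℝ) := (fun b => rateVec H b Q) '' F with hT
  have hcont : Continuous fun b : Equiv.Perm (Fin K) → ℝ => rateVec H b Q := by
    refine continuous_pi fun k => ?_
    simp only [rateVec]
    fun_prop
  have hTcompact : IsCompact T := hFcompact.image hcont
  have hTconvex : Convex ℝ T := by
    rintro _ ⟨b, hb, rfl⟩ _ ⟨c, hc, rfl⟩ s t hs ht hst
    exact ⟨s • b + t • c, hFconvex hb hc hs ht hst, rateVec_add_smul H b c s t Q⟩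
  by_cases hx : rateVec H β Q ∈ T
  · obtain ⟨β', hβ', heq⟩ := hx
    refine ⟨β', hβ'.1, heq, fun π hπ => ?_⟩
    by_contra hmon
    exact hπ.ne' (hβ'.2 π hmon)
  · exfalso
    obtain ⟨l, u, hlT, hlx⟩ := geometric_hahn_banach_closed_point hTconvex hTcompact.isClosed hx
    set v : Fin K → ℝ := fun k => l (Pi.single k 1) with hv
    have hl : ∀ y : Fin K → ℝ, l y = ∑ k, v k * y k := dual_apply_eq_sum l
    obtain ⟨ε, hε, hmono⟩ := exists_monotone_perturbation w v
    set w' : Fin K → ℝ := fun k => w k + ε * v k with hw'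
    have hsort : Monotone fun j => w' (Tuple.sort w' j) := Tuple.monotone_sort w'
    set π := Tuple.sort w' with hπ
    have hsplit : ∀ y : Fin K → ℝ,
        ∑ k, w' k * y k = ∑ k, w k * y k + ε * ∑ k, v k * y k := by
      intro y
      rw [Finset.mul_sum, ← Finset.sum_add_distrib]
      exact Finset.sum_congr rfl fun k _ => by simp only [hw']; ring
    have hπF : Pi.single π 1 ∈ F := by
      refine ⟨single_mem_stdSimplex ℝ π, fun τ hτ => ?_⟩
      have : τ ≠ π := fun h => hτ (h ▸ hmono π hsort)
      simp [this]
    have h1 : ∑ k, v k * rate H π k Q < ∑ k, v k * rateVec H β Q k := by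
      have := (hlT _ ⟨_, hπF, rfl⟩).trans hlx
      rw [hl, hl] at this
      simpa only [rateVec_single] using this
    have h2 : ∑ k, w' k * rateVec H β Q k ≤ ∑ k, w' k * rate H π k Q := by
      rw [sum_mul_rateVec]
      exact sum_simplex_mul_le hβ fun π' =>
        isOptimalOrder_of_monotone H (P := {Q}) (by rintro _ rfl; exact hQ) hsort Q rfl π'
    rw [hsplit, hsplit] at h2
    have := mul_lt_mul_of_pos_left h1 hε
    linarith [hw π]

lemma rateVec_segment (H : Channel NR N) (β β' : Equiv.Perm (Fin K) → ℝ) (Q : CompCov N)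
    (δ : ℝ) : rateVec H (δ • β' + (1 - δ) • β) Q
      = δ • rateVec H β' Q + (1 - δ) • rateVec H β Q := rateVec_add_smul H β' β δ (1 - δ) Q

/-- A minimizing time-sharing vector that uses only optimum decoding orders exists. -/
lemma exists_isTimeSharing (H : Channel NR N) {P : Set (CompCov N)} {f : (Fin K → ℝ) → ℝ}
    {U : Set (Fin K → ℝ)} (hP : ∀ Q ∈ P, ∀ k, (Q k).PosSemidef) (hUopen : IsOpen U)
    (hUrates : ∀ β ∈ stdSimplex ℝ (Equiv.Perm (Fin K)), ∀ Q ∈ P, rateVec H β Q ∈ U)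
    (hf : DifferentiableOn ℝ f U) {Q : CompCov N} (hQ : Q ∈ P) :
    ∃ β, IsTimeSharing H P f Q β := by
  have hcont : ContinuousOn (fun β => f (rateVec H β Q)) (stdSimplex ℝ (Equiv.Perm (Fin K))) := by
    refine hf.continuousOn.comp ?_ fun β hβ => hUrates β hβ Q hQ
    refine Continuous.continuousOn (continuous_pi fun k => ?_)
    simp only [rateVec]
    fun_prop
  obtain ⟨β, hβ, hmin⟩ := (isCompact_stdSimplex ℝ (Equiv.Perm (Fin K))).exists_isMinOn
    ⟨_, single_mem_stdSimplex ℝ 1⟩ hcont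
  set x := rateVec H β Q with hx
  have hfx : DifferentiableAt ℝ f x := hf.differentiableAt (hUopen.mem_nhds (hUrates β hβ Q hQ))
  -- First-order optimality of `β` along the segment towards the single order `π`.
  have hfirst : ∀ π, ∑ k, weights f x k * rate H π k Q ≤ ∑ k, weights f x k * x k := by
    intro π
    set y := rateVec H (Pi.single π 1) Q with hy
    have hfx' : HasFDerivAt f (fderiv ℝ f x) ((fun δ : ℝ => δ • y + (1 - δ) • x) 0) := by
      simpa using hfx.hasFDerivAt
    have h0 : 0 ≤ fderiv ℝ f x (y - x) := by
      refine le_deriv_of_le (hfx'.comp_hasDerivAt 0 (hasDerivAt_segment x y 0)) ?_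
      filter_upwards [Ioo_mem_nhdsGT (zero_lt_one' ℝ)] with δ hδ
      have hmem := convex_stdSimplex ℝ (Equiv.Perm (Fin K)) (single_mem_stdSimplex ℝ π) hβ hδ.1.le
        (sub_nonneg.2 hδ.2.le) (by ring)
      have := hmin hmem
      simp only [Set.mem_ofPred_eq, rateVec_segment, Function.comp_apply] at this ⊢
      simpa using this
    rw [fderiv_apply_eq_neg_sum] at h0
    simp only [Pi.sub_apply, mul_sub, Finset.sum_sub_distrib, hy, rateVec_single] at h0
    linarith
  -- Replacing `β` by `β'` keeps the rate vector, hence both minimality and the weights.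
  obtain ⟨β', hβ', heq, hmono⟩ := exists_simplex_monotone_rateVec_eq H (hP Q hQ) hβ hfirst
  refine ⟨β', hβ', fun b hb => ?_, fun π hπ => ?_⟩
  · rw [heq]; exact hmin hb
  · rw [heq]; exact isOptimalOrder_of_monotone H hP (hmono π hπ)

end TimeSharing

/-! ### Armijo steps and an abstract descent argument. -/

section Armijo

lemma exists_isArmijoStep (σ : ℝ) {χ : ℝ} (hχ : χ ∈ Set.Ioo (0 : ℝ) 1) (h : ℝ → ℝ) :
    ∃ ε, IsArmijoStep σ χ h ε := by
  classical
  by_cases hne : armijoSet σ χ h = ∅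
  · exact ⟨0, Or.inr ⟨hne, rfl⟩⟩
  · have hex : ∃ n : ℕ, χ ^ n ∈ armijoSet σ χ h := by
      obtain ⟨ε, hε⟩ := Set.nonempty_iff_ne_empty.2 hne
      obtain ⟨n, rfl⟩ := hε.1
      exact ⟨n, hε⟩
    refine ⟨χ ^ Nat.find hex, Or.inl ⟨Nat.find_spec hex, ?_⟩⟩
    rintro ε hε
    obtain ⟨n, rfl⟩ := hε.1
    exact pow_le_pow_of_le_one hχ.1.le hχ.2.le (Nat.find_min' hex hε)

lemma IsArmijoStep.mem_Icc {σ χ ε : ℝ} {h : ℝ → ℝ} (hχ : χ ∈ Set.Ioo (0 : ℝ) 1)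
    (hε : IsArmijoStep σ χ h ε) : ε ∈ Set.Icc (0 : ℝ) 1 := by
  rcases hε with hε | hε
  · obtain ⟨n, rfl⟩ := hε.1.1
    exact ⟨pow_nonneg hχ.1.le n, pow_le_one₀ hχ.1.le hχ.2.le⟩
  · rw [hε.2]; exact ⟨le_rfl, zero_le_one⟩

lemma IsArmijoStep.le {σ χ ε : ℝ} {h : ℝ → ℝ} (hε : IsArmijoStep σ χ h ε) :
    h ε ≤ h 0 + σ * ε * deriv h 0 := by
  rcases hε with hε | hε
  · exact hε.1.2
  · rw [hε.2]; simp

/-- One admissible power bounds the step from below and rules out the default value `0`. -/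
lemma IsArmijoStep.pow_le {σ χ ε : ℝ} {h : ℝ → ℝ} (hε : IsArmijoStep σ χ h ε) {n : ℕ}
    (hn : h (χ ^ n) ≤ h 0 + σ * χ ^ n * deriv h 0) : χ ^ n ≤ ε := by
  have hmem : χ ^ n ∈ armijoSet σ χ h := ⟨⟨n, rfl⟩, hn⟩
  rcases hε with hε | hε
  · exact hε.2 hmem
  · rw [hε.1] at hmem; exact absurd hmem (Set.notMem_empty _)

/-- The sequence decreases to some `l`; if `l` were positive, every step would lower it by a fixed
positive amount. -/
lemma tendsto_zero_of_descent {a e : ℕ → ℝ} {σ : ℝ} (hσ : 0 < σ) (ha : ∀ t, 0 ≤ a t)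
    (he : ∀ t, 0 ≤ e t) (hstep : ∀ t, a (t + 1) ≤ a t - σ * e t * a t)
    (hlow : ∀ g > 0, ∃ e₀ > 0, ∀ t, g ≤ a t → e₀ ≤ e t) : Tendsto a atTop (𝓝 0) := by
  have hanti : Antitone a := antitone_nat_of_succ_le fun t => by
    have := mul_nonneg (mul_nonneg hσ.le (he t)) (ha t)
    linarith [hstep t]
  have hbdd : BddBelow (Set.range a) := ⟨0, by rintro _ ⟨t, rfl⟩; exact ha t⟩
  have hlim := tendsto_atTop_ciInf hanti hbdd
  set l := ⨅ t, a t with hl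
  have hl0 : 0 ≤ l := le_ciInf ha
  rcases eq_or_lt_of_le hl0 with h | h
  · rwa [← h] at hlim
  · exfalso
    obtain ⟨e₀, he₀, hle⟩ := hlow l h
    have hal : ∀ t, l ≤ a t := fun t => ciInf_le hbdd t
    have hs : ∀ t, a (t + 1) ≤ a t - σ * e₀ * l := by
      intro t
      have h1 : σ * e₀ * l ≤ σ * e t * a t :=
        mul_le_mul (mul_le_mul_of_nonneg_left (hle t (hal t)) hσ.le) (hal t) hl0
          (mul_nonneg hσ.le (he t))
      linarith [hstep t]
    have := le_of_tendsto_of_tendsto' (hlim.comp (tendsto_add_atTop_nat 1))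
      (hlim.sub_const (σ * e₀ * l)) hs
    have hpos := mul_pos (mul_pos hσ he₀) h
    linarith

end Armijo

/-! ### Duality gap, existence of runs, and convergence. -/

section Convergence

variable {K NR : ℕ} {N : Fin K → ℕ}

attribute [local instance] Matrix.normedAddCommGroup Matrix.normedSpace

lemma weights_nonneg {f : (Fin K → ℝ) → ℝ} {U : Set (Fin K → ℝ)} (hUopen : IsOpen U)
    (hf : DifferentiableOn ℝ f U)
    (hfmono : ∀ x ∈ U, ∀ k : Fin K, ∀ s : ℝ, x k ≤ s → Function.update x k s ∈ U →
      f (Function.update x k s) ≤ f x) {x : Fin K → ℝ} (hx : x ∈ U) (k : Fin K) :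
    0 ≤ weights f x k := by
  have hup : ∀ δ : ℝ, Function.update x k (x k + δ) = x + δ • Pi.single k 1 := by
    intro δ
    ext i
    by_cases h : i = k
    · subst h; simp
    · simp [h]
  have hline : HasDerivAt (fun δ : ℝ => x + δ • (Pi.single k 1 : Fin K → ℝ)) (Pi.single k 1) 0 := by
    have h : HasDerivAt (fun δ : ℝ => x + δ • (Pi.single k 1 : Fin K → ℝ))
        ((1 : ℝ) • Pi.single k 1) 0 := ((hasDerivAt_id (0 : ℝ)).smul_const _).const_add x
    rwa [one_smul] at h
  have hfx : HasFDerivAt f (fderiv ℝ f x)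
      ((fun δ : ℝ => x + δ • (Pi.single k 1 : Fin K → ℝ)) 0) := by
    simpa using (hf.differentiableAt (hUopen.mem_nhds hx)).hasFDerivAt
  refine le_deriv_of_le (hfx.comp_hasDerivAt 0 hline).neg ?_
  have hmem : ∀ᶠ δ in 𝓝[>] (0 : ℝ), x + δ • (Pi.single k 1 : Fin K → ℝ) ∈ U := by
    refine nhdsWithin_le_nhds (hline.continuousAt.eventually_mem (hUopen.mem_nhds ?_))
    simpa using hx
  filter_upwards [hmem, self_mem_nhdsWithin] with δ hδ hpos
  have := hfmono x hx k (x k + δ) (le_add_of_nonneg_right (le_of_lt hpos)) (by rwa [hup])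
  rw [hup] at this
  simpa using this

/-- The duality gap: the distance to any feasible objective value is at most the descent rate
along the search direction. -/
lemma sub_le_neg_deriv_lineObjective (H : Channel NR N) {P : Set (CompCov N)}
    {f : (Fin K → ℝ) → ℝ} {U : Set (Fin K → ℝ)} (hP : ∀ Q ∈ P, ∀ k, (Q k).PosSemidef)
    (hPconvex : Convex ℝ P) (hUopen : IsOpen U)
    (hUrates : ∀ β ∈ stdSimplex ℝ (Equiv.Perm (Fin K)), ∀ Q ∈ P, rateVec H β Q ∈ U)
    (hf : DifferentiableOn ℝ f U)
    (hfmono : ∀ x ∈ U, ∀ k : Fin K, ∀ s : ℝ, x k ≤ s → Function.update x k s ∈ U →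
      f (Function.update x k s) ≤ f x)
    (hfconvex : ConvexOn ℝ U f) {β β' : Equiv.Perm (Fin K) → ℝ} {Q Q' Qs : CompCov N}
    (hQ : Q ∈ P) (hβ : IsTimeSharing H P f Q β)
    (hQs : IsCovSolution H P (weights f (rateVec H β Q)) Qs)
    (hβ' : β' ∈ stdSimplex ℝ (Equiv.Perm (Fin K))) (hQ' : Q' ∈ P) :
    f (rateVec H β Q) - f (rateVec H β' Q') ≤ -deriv (lineObjective H f β Q Qs) 0 := by
  set x := rateVec H β Q with hx
  set w := weights f x with hw
  have hxU : x ∈ U := hUrates β hβ.1 Q hQ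
  have hfx : DifferentiableAt ℝ f x := hf.differentiableAt (hUopen.mem_nhds hxU)
  obtain ⟨π, hπ, hQsP, hmax⟩ := hQs
  have hπopt := isOptimalOrder_of_monotone H hP hπ
  -- Any two optimum orders tie at every point of `P`, so the identity holds along whole segments
  -- and can be differentiated.
  have hon : ∀ R ∈ P, ∑ k, w k * rateVec H β R k = covObjective H w π R := by
    intro R hR
    rw [sum_mul_rateVec, covObjective_eq H (hP R hR)]
    have : ∀ τ, β τ * ∑ k, w k * rate H τ k R = β τ * ∑ k, w k * rate H π k R := by
      intro τ
      rcases eq_or_lt_of_le (hβ.1.1 τ) with h | h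
      · rw [← h]; simp
      · rw [le_antisymm (hπopt R hR τ) (hβ.2.2 τ h R hR π)]
    rw [Finset.sum_congr rfl fun τ _ => this τ, ← Finset.sum_mul, hβ.1.2, one_mul]
  have hgap : f x - f (rateVec H β' Q') ≤ covObjective H w π Qs - covObjective H w π Q := by
    have h1 := fderiv_sub_le_sub hfconvex hxU (hUrates β' hβ' Q' hQ') hfx
    rw [fderiv_apply_eq_neg_sum, ← hw] at h1
    simp only [Pi.sub_apply, mul_sub, Finset.sum_sub_distrib] at h1
    have h2 : ∑ k, w k * rateVec H β' Q' k ≤ covObjective H w π Q' := by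
      rw [sum_mul_rateVec, covObjective_eq H (hP Q' hQ')]
      exact sum_simplex_mul_le hβ' fun τ => hπopt Q' hQ' τ
    have h3 : ∑ k, w k * x k = covObjective H w π Q := hon Q hQ
    linarith [hmax Q' hQ']
  have h0 : (0 : ℝ) • Qs + (1 - (0 : ℝ)) • Q = Q := by simp
  have hsm : (0 : ℝ) • Qs + (1 - (0 : ℝ)) • Q ∈ smoothSet H := by
    rw [h0]; exact mem_smoothSet H (hP Q hQ)
  have hder := hasDerivAt_lineObjective H (f := f) β Q Qs hsm (by rw [h0]; exact hfx)
  have hrate := hasDerivAt_rateVec_segment H β Q Qs hsm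
  rw [hder.deriv, h0, fderiv_apply_eq_neg_sum, neg_neg, ← hx, ← hw]
  rw [h0] at hrate
  have hψ : HasDerivAt (fun δ : ℝ => ∑ k, w k * rateVec H β (δ • Qs + (1 - δ) • Q) k)
      (∑ k, w k * rateVecDeriv H β Q (Qs - Q) k) 0 :=
    HasDerivAt.fun_sum fun k _ => (hasDerivAt_pi.1 hrate k).const_mul (w k)
  refine hgap.trans (le_deriv_of_le hψ ?_)
  filter_upwards [Ioo_mem_nhdsGT (zero_lt_one' ℝ)] with δ hδ
  have hmem : δ • Qs + (1 - δ) • Q ∈ P :=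
    hPconvex hQsP hQ hδ.1.le (sub_nonneg.2 hδ.2.le) (by ring)
  have hcc := covObjective_concave H (weights_nonneg hUopen hf hfmono hxU) hπ (hP Q hQ)
    (hP Qs hQsP) hδ.1.le hδ.2.le
  rw [h0, hon _ hmem, hon Q hQ]
  linarith

lemma exists_isCovSolution (H : Channel NR N) {P : Set (CompCov N)}
    (hP : ∀ Q ∈ P, ∀ k, (Q k).PosSemidef) (hPcompact : IsCompact P) (hne : P.Nonempty)
    (w : Fin K → ℝ) : ∃ Q, IsCovSolution H P w Q := by
  have hcont : ContinuousOn (covObjective H w (Tuple.sort w)) P := by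
    refine continuousOn_finsetSum _ fun k _ => continuousOn_const.mul ?_
    exact (contDiff_sigDet H _ _).continuous.continuousOn.log
      fun Q hQ => (sigDet_pos H (hP Q hQ) _ _).ne'
  obtain ⟨Q, hQ, hmax⟩ := hPcompact.exists_isMaxOn hne hcont
  exact ⟨Q, Tuple.sort w, Tuple.monotone_sort w, hQ, fun Q' hQ' => hmax hQ'⟩

lemma exists_isOptimum (H : Channel NR N) {P : Set (CompCov N)} {f : (Fin K → ℝ) → ℝ}
    {U : Set (Fin K → ℝ)} (hP : ∀ Q ∈ P, ∀ k, (Q k).PosSemidef) (hPcompact : IsCompact P)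
    (hne : P.Nonempty)
    (hUrates : ∀ β ∈ stdSimplex ℝ (Equiv.Perm (Fin K)), ∀ Q ∈ P, rateVec H β Q ∈ U)
    (hf : ContinuousOn f U) : ∃ β Q, IsOptimum H P f β Q := by
  have hcont : ContinuousOn (fun p : (Equiv.Perm (Fin K) → ℝ) × CompCov N => f (rateVec H p.1 p.2))
      (stdSimplex ℝ (Equiv.Perm (Fin K)) ×ˢ P) :=
    hf.comp ((continuousOn_rateVec H).mono fun p hp => ⟨trivial, mem_smoothSet H (hP _ hp.2)⟩)
      fun p hp => hUrates _ hp.1 _ hp.2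
  obtain ⟨p, hp, hmin⟩ := ((isCompact_stdSimplex ℝ (Equiv.Perm (Fin K))).prod
    hPcompact).exists_isMinOn (Set.Nonempty.prod ⟨_, single_mem_stdSimplex ℝ 1⟩ hne) hcont
  exact ⟨p.1, p.2, hp.1, hp.2, fun β hβ Q hQ => hmin (Set.mk_mem_prod hβ hQ)⟩

lemma mem_of_isArmijoStep {P : Set (CompCov N)} (hPconvex : Convex ℝ P) {σ χ ε : ℝ} {h : ℝ → ℝ}
    (hχ : χ ∈ Set.Ioo (0 : ℝ) 1) (hε : IsArmijoStep σ χ h ε) {Q Qs : CompCov N} (hQ : Q ∈ P)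
    (hQs : Qs ∈ P) : ε • Qs + (1 - ε) • Q ∈ P :=
  hPconvex hQs hQ (hε.mem_Icc hχ).1 (sub_nonneg.2 (hε.mem_Icc hχ).2) (by ring)

lemma IsCovSolution.mem {H : Channel NR N} {P : Set (CompCov N)} {w : Fin K → ℝ} {Q : CompCov N}
    (h : IsCovSolution H P w Q) : Q ∈ P := by
  obtain ⟨_, _, hQ, _⟩ := h
  exact hQ

lemma exists_isRun (H : Channel NR N) {P : Set (CompCov N)} {f : (Fin K → ℝ) → ℝ}
    {U : Set (Fin K → ℝ)} (σ : ℝ) {χ : ℝ} (hχ : χ ∈ Set.Ioo (0 : ℝ) 1)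
    (hP : ∀ Q ∈ P, ∀ k, (Q k).PosSemidef) (hPcompact : IsCompact P) (hPconvex : Convex ℝ P)
    (hUopen : IsOpen U)
    (hUrates : ∀ β ∈ stdSimplex ℝ (Equiv.Perm (Fin K)), ∀ Q ∈ P, rateVec H β Q ∈ U)
    (hf : DifferentiableOn ℝ f U) {β₀ : Equiv.Perm (Fin K) → ℝ}
    (hβ₀ : β₀ ∈ stdSimplex ℝ (Equiv.Perm (Fin K))) {Q₀ : CompCov N} (hQ₀ : Q₀ ∈ P) :
    ∃ (β : ℕ → Equiv.Perm (Fin K) → ℝ) (Q Qs : ℕ → CompCov N) (ε : ℕ → ℝ),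
      IsRun H P f σ χ β Q Qs ε ∧ β 0 = β₀ ∧ Q 0 = Q₀ := by
  choose search hsearch using exists_isCovSolution H hP hPcompact ⟨Q₀, hQ₀⟩
  choose step hstep using exists_isArmijoStep σ hχ
  -- Stated for all `Q` so that the recursion is total; `hmem` shows that the default outside `P` is
  -- never used.
  have htime : ∀ Q : CompCov N, ∃ β, Q ∈ P → IsTimeSharing H P f Q β := by
    intro Q
    by_cases hQ : Q ∈ P
    · obtain ⟨β, hβ⟩ := exists_isTimeSharing H hP hUopen hUrates hf hQ
      exact ⟨β, fun _ => hβ⟩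
    · exact ⟨0, fun h => absurd h hQ⟩
  choose share hshare using htime
  set nextCov : (Equiv.Perm (Fin K) → ℝ) × CompCov N → CompCov N :=
    fun s => search (weights f (rateVec H s.1 s.2)) with hnextCov
  set nextStep : (Equiv.Perm (Fin K) → ℝ) × CompCov N → ℝ :=
    fun s => step (lineObjective H f s.1 s.2 (nextCov s)) with hnextStep
  set next : (Equiv.Perm (Fin K) → ℝ) × CompCov N → CompCov N :=
    fun s => nextStep s • nextCov s + (1 - nextStep s) • s.2 with hnext
  set state : ℕ → (Equiv.Perm (Fin K) → ℝ) × CompCov N :=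
    fun t => Nat.rec (β₀, Q₀) (fun _ s => (share (next s), next s)) t with hstate
  have hmem : ∀ t, (state t).2 ∈ P := by
    intro t
    induction t with
    | zero => exact hQ₀
    | succ t ih => exact mem_of_isArmijoStep hPconvex hχ (hstep _) ih (hsearch _).mem
  -- Search points and step sizes are indexed from `1`; their values at `0` are irrelevant.
  exact ⟨fun t => (state t).1, fun t => (state t).2, fun t => nextCov (state (t - 1)),
    fun t => nextStep (state (t - 1)),
    { init_time := hβ₀
      init_cov := hQ₀
      search := fun t => hsearch _
      stepsize := fun t => hstep _
      update := fun t => rfl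
      time := fun t => hshare _ (hmem (t + 1)) }, rfl, rfl⟩

lemma IsRun.cov_mem {H : Channel NR N} {P : Set (CompCov N)} {f : (Fin K → ℝ) → ℝ} {σ χ : ℝ}
    {β : ℕ → Equiv.Perm (Fin K) → ℝ} {Q Qs : ℕ → CompCov N} {ε : ℕ → ℝ}
    (hrun : IsRun H P f σ χ β Q Qs ε) (hPconvex : Convex ℝ P) (hχ : χ ∈ Set.Ioo (0 : ℝ) 1)
    (t : ℕ) : Q t ∈ P := by
  induction t with
  | zero => exact hrun.init_cov
  | succ t ih =>
    rw [hrun.update t]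
    exact mem_of_isArmijoStep hPconvex hχ (hrun.stepsize t) ih (hrun.search t).mem

lemma IsRun.tendsto (H : Channel NR N) {P : Set (CompCov N)} {f : (Fin K → ℝ) → ℝ}
    {U : Set (Fin K → ℝ)} {σ χ : ℝ} (hσ : σ ∈ Set.Ioo (0 : ℝ) 1) (hχ : χ ∈ Set.Ioo (0 : ℝ) 1)
    (hP : ∀ Q ∈ P, ∀ k, (Q k).PosSemidef) (hPcompact : IsCompact P) (hPconvex : Convex ℝ P)
    (hUopen : IsOpen U)
    (hUrates : ∀ β ∈ stdSimplex ℝ (Equiv.Perm (Fin K)), ∀ Q ∈ P, rateVec H β Q ∈ U)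
    (hf : DifferentiableOn ℝ f U) (hf' : ContinuousOn (fderiv ℝ f) U)
    (hfmono : ∀ x ∈ U, ∀ k : Fin K, ∀ s : ℝ, x k ≤ s → Function.update x k s ∈ U →
      f (Function.update x k s) ≤ f x)
    (hfconvex : ConvexOn ℝ U f)
    {β : ℕ → Equiv.Perm (Fin K) → ℝ} {Q Qs : ℕ → CompCov N} {ε : ℕ → ℝ}
    (hrun : IsRun H P f σ χ β Q Qs ε) {βo : Equiv.Perm (Fin K) → ℝ} {Qo : CompCov N}
    (hopt : IsOptimum H P f βo Qo) :
    Tendsto (fun t => f (rateVec H (β t) (Q t)) - f (rateVec H βo Qo)) atTop (𝓝 0) := by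
  have hQ := hrun.cov_mem hPconvex hχ
  have hzero : ∀ t, lineObjective H f (β t) (Q t) (Qs (t + 1)) 0 = f (rateVec H (β t) (Q t)) := by
    intro t; simp [lineObjective]
  have hgap : ∀ t, f (rateVec H (β (t + 1)) (Q (t + 1))) - f (rateVec H βo Qo)
      ≤ -deriv (lineObjective H f (β (t + 1)) (Q (t + 1)) (Qs (t + 2))) 0 := fun t =>
    sub_le_neg_deriv_lineObjective H hP hPconvex hUopen hUrates hf hfmono hfconvex (hQ (t + 1))
      (hrun.time t) (hrun.search (t + 1)) hopt.1 hopt.2.1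
  have hεnn : ∀ t, 0 ≤ ε (t + 2) := fun t => ((hrun.stepsize (t + 1)).mem_Icc hχ).1
  -- The initial `β` may use orders that are not optimum, so the gap bound starts at time `1`.
  rw [← tendsto_add_atTop_iff_nat 1]
  refine tendsto_zero_of_descent (e := fun t => ε (t + 2)) hσ.1 ?_ hεnn ?_ ?_
  · intro t
    exact sub_nonneg.2 (hopt.2.2 _ (hrun.time t).1 _ (hQ _))
  · intro t
    -- Reoptimizing `β` cannot raise the objective, so the Armijo decrease survives.
    have h1 := (hrun.time (t + 1)).2.1 _ (hrun.time t).1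
    have h2 := (hrun.stepsize (t + 1)).le
    rw [hzero, lineObjective, ← hrun.update (t + 1)] at h2
    have h3 := mul_le_mul_of_nonneg_left (hgap t) (mul_nonneg hσ.1.le (hεnn t))
    linarith
  · intro g hg
    -- With slope `d ≤ -g`, the error `(1 - σ) * g` is at most `-(1 - σ) * d`, so the bound becomes
    -- the Armijo condition with slope `σ * d`.
    obtain ⟨δ₀, hδ₀, hle⟩ := exists_lineObjective_le H hP hPcompact hPconvex hUopen hUrates hf hf'
      (mul_pos (sub_pos.2 hσ.2) hg)
    obtain ⟨n, hn⟩ := exists_pow_lt_of_lt_one hδ₀ hχ.2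
    have hpos := pow_pos hχ.1 n
    refine ⟨χ ^ n, hpos, fun t ht => (hrun.stepsize (t + 1)).pow_le ?_⟩
    refine (hle _ (hrun.time t).1 _ (hQ (t + 1)) _ (hrun.search (t + 1)).mem _ hpos hn.le
      (pow_le_one₀ hχ.1.le hχ.2.le)).trans ?_
    have h1 := mul_le_mul_of_nonneg_left (ht.trans (hgap t))
      (mul_nonneg hpos.le (sub_pos.2 hσ.2).le)
    nlinarith

end Convergence

end GMAC

theorem mainTheorem7 {K NR L : ℕ} {N : Fin K → ℕ} (H : GMAC.Channel NR N)
    (g : Fin L → GMAC.CompCov N → ℝ) (f : (Fin K → ℝ) → ℝ) (U : Set (Fin K → ℝ)) (σ χ : ℝ)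
    (hσ : σ ∈ Set.Ioo (0 : ℝ) 1) (hχ : χ ∈ Set.Ioo (0 : ℝ) 1)
    (hPcompact : IsCompact (GMAC.feasible g))
    (hPconvex : Convex ℝ (GMAC.feasible g))
    (hUopen : IsOpen U)
    (hUrates : ∀ β ∈ stdSimplex ℝ (Equiv.Perm (Fin K)), ∀ Q ∈ GMAC.feasible g,
      GMAC.rateVec H β Q ∈ U)
    (hfdiff : DifferentiableOn ℝ f U) (hfdiff2 : DifferentiableOn ℝ (fderiv ℝ f) U)
    (hfmono : ∀ x ∈ U, ∀ k : Fin K, ∀ s : ℝ, x k ≤ s → Function.update x k s ∈ U →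
      f (Function.update x k s) ≤ f x)
    (hfconvex : ConvexOn ℝ U f) :
    (∀ β₀ ∈ stdSimplex ℝ (Equiv.Perm (Fin K)), ∀ Q₀ ∈ GMAC.feasible g,
      ∃ (β : ℕ → Equiv.Perm (Fin K) → ℝ) (Q Qs : ℕ → GMAC.CompCov N) (ε : ℕ → ℝ),
        GMAC.IsRun H (GMAC.feasible g) f σ χ β Q Qs ε ∧ β 0 = β₀ ∧ Q 0 = Q₀) ∧
    (∀ (β : ℕ → Equiv.Perm (Fin K) → ℝ) (Q Qs : ℕ → GMAC.CompCov N) (ε : ℕ → ℝ),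
      GMAC.IsRun H (GMAC.feasible g) f σ χ β Q Qs ε →
        (∃ βo Qo, GMAC.IsOptimum H (GMAC.feasible g) f βo Qo) ∧
        ∀ βo Qo, GMAC.IsOptimum H (GMAC.feasible g) f βo Qo →
          Tendsto (fun t => f (GMAC.rateVec H (β t) (Q t)) - f (GMAC.rateVec H βo Qo))
            atTop (𝓝 0)) := by
  have hP : ∀ Q ∈ GMAC.feasible g, ∀ k, (Q k).PosSemidef := fun Q hQ => hQ.1
  refine ⟨fun β₀ hβ₀ Q₀ hQ₀ => GMAC.exists_isRun H σ hχ hP hPcompact hPconvex hUopen hUrates hfdiff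
    hβ₀ hQ₀, fun β Q Qs ε hrun => ⟨?_, fun βo Qo hopt => ?_⟩⟩
  · exact GMAC.exists_isOptimum H hP hPcompact ⟨_, hrun.init_cov⟩ hUrates hfdiff.continuousOn
  · exact hrun.tendsto H hσ hχ hP hPcompact hPconvex hUopen hUrates hfdiff hfdiff2.continuousOn
      hfmono hfconvex hopt
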